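/- **Corollary (Privacy guarantee of federated LoRA and FFA-LoRA).** *Setting.* A global dataset $D$ is a finite set of records; a fixed ownership map assigns every possible record to one of $n$ clients, so that the client datasets $D_1,\dots,D_n$ are disjoint chunks of $D$. Two datasets are *neighbouring* if they differ in exactly one record (one record is added, removed or replaced). A randomized algorithm $M$ is $(\varepsilon,\delta)$-DP if $\Pr[M(D)\in S]\le e^{\varepsilon}\Pr[M(D')\in S]+\delta$ for all neighbouring $D,D'$ and all measurable sets $S$ of outputs. The model has adapted weight matrices $W_l = W_{0,l}+\frac{\alpha}{r}B_lA_l$ with $W_{0,l}\in\mathbb R^{d_l\times k_l}$ frozen, $B_l\in\mathbb R^{d_l\times r}$, $A_l\in\mathbb R^{r\times k_l}$. In LoRA the trainable vector $\theta$ consists of all entries of all $A_l,B_l$; in FFA-LoRA the $A_l$ are frozen at data-independent values and $\theta$ consists of the entries of the $B_l$. Let $g_z(\theta)$ be the gradient with respect to $\theta$ of the loss of the record $z$ (read as $0$ where the loss is not differentiable). *Training.* It has $R$ rounds. In every round each client $i$ starts from the current global $\theta$ and performs $\tau$ DP-SGD steps $$\theta\leftarrow\theta-\frac{\eta}{b_i}\Big(\sum_{z\in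 S}\frac{g_z(\theta)}{\max(1,\|g_z(\theta)\|_2/C)}+\xi\Big),\qquad \xi\sim\mathcal N(0,C^2\sigma^2 I),$$ where the batch $S$ contains every record of $D_i$ independently with probability $q\in(0,1]$, $C>0$ is the clipping threshold and $b_i>0$ is a fixed nominal batch size; all batches and noises are independent. Each client uploads its result, and the server takes as the new global $\theta$ the average of the uploads with fixed weights $w_i\ge 0$, $\sum_i w_i=1$. The initial $\theta$ is arbitrary and independent of the data. Let $T=R\tau$ be the total number of local updates of each client. *Claim.* For every $K>0$ there is a constant $c>0$, depending only on $K$, such that for all $\varepsilon>0$ and $\delta\in(0,1)$ with $\varepsilon\le K q^2T$ and $\varepsilon\le K\log(1/\delta)$, and every noise multiplier $$\sigma\ \ge\ c\,\frac{q\sqrt{T\log(1/\delta)}}{\varepsilon},$$ federated training of LoRA and federated training of FFA-LoRA are both $(\varepsilon,\delta)$-DP, both when the output consists of all uploads of all clients in all rounds together with the final parameters, and when only the final parameters are published. -/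

import Mathlib

open MeasureTheory ProbabilityTheory

noncomputable section

/-! ### Differential privacy -/

/-- Two datasets (finite sets of records) are neighbouring when they differ in exactly one record:
one record is added, removed, or replaced by another one. -/
def Neighboring {Z : Type*} (D D' : Finset Z) : Prop :=
  (∃ (z : Z) (h : z ∉ D), D' = D.cons z h) ∨
  (∃ (z : Z) (h : z ∉ D'), D = D'.cons z h) ∨
  (∃ (S : Finset Z) (x y : Z) (hx : x ∉ S) (hy : y ∉ S),
    x ≠ y ∧ D = S.cons x hx ∧ D' = S.cons y hy)

/-- `(ε, δ)`-differential privacy of a randomized algorithm `M`, given by its output law on every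
dataset. -/
def IsDP {Z Ω : Type*} [MeasurableSpace Ω] (ε δ : ℝ) (M : Finset Z → Measure Ω) : Prop :=
  (∀ D, IsProbabilityMeasure (M D)) ∧
  ∀ D D' : Finset Z, Neighboring D D' → ∀ S : Set Ω, MeasurableSet S →
    M D S ≤ ENNReal.ofReal (Real.exp ε) * M D' S + ENNReal.ofReal δ

/-! ### DP-SGD and FedAvg -/

/-- The hyper-parameters of federated training with `n` clients. -/
structure FedConfig (n : ℕ) where
  /-- number of communication rounds -/
  rounds : ℕ
  /-- number of local DP-SGD steps of each client in each round -/
  localSteps : ℕ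
  /-- sampling rate of the mini-batches -/
  q : ℝ
  /-- noise multiplier -/
  σ : ℝ
  /-- clipping threshold -/
  C : ℝ
  /-- learning rate -/
  η : ℝ
  /-- nominal (that is, expected) batch size of each client, by which the noisy gradient sum is
  divided -/
  batch : Fin n → ℝ
  /-- aggregation weight of each client -/
  weight : Fin n → ℝ

/-- The number of local updates that each client performs in total. -/
def FedConfig.totalSteps {n : ℕ} (cfg : FedConfig n) : ℕ := cfg.rounds * cfg.localSteps

/-- Clipping of a per-sample gradient to norm at most `C`. -/
def clip {E : Type*} [NormedAddCommGroup E] [NormedSpace ℝ E] (C : ℝ) (g : E) : E :=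
  (max 1 (‖g‖ / C))⁻¹ • g

section Training

variable {Z E : Type*} [NormedAddCommGroup E] [InnerProductSpace ℝ E] [FiniteDimensional ℝ E]
  [MeasurableSpace E]

/-- The law of one DP-SGD update from the parameters `θ` on the dataset `D`, for the per-sample
gradients `g z θ`. Every record enters the batch `S` independently with probability `q`;
then Gaussian noise `z ∼ N(0, C² σ² I)` is added to the sum of the clipped gradients, and the
result divided by `b` replaces the gradient. -/
def dpsgdStep (q σ C η b : ℝ) (g : Z → E → E) (D : Finset Z) (θ : E) : Measure E :=
  ∑ S ∈ D.powerset, ENNReal.ofReal (q ^ S.card * (1 - q) ^ (D.card - S.card)) •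
    (stdGaussian E).map fun ξ =>
      θ - η • (b⁻¹ • ((∑ z ∈ S, clip C (g z θ)) + (C * σ) • ξ))

/-- The law of the parameters after `s` successive DP-SGD updates on `D`, started at `θ`. -/
def dpsgdRun (q σ C η b : ℝ) (g : Z → E → E) (D : Finset Z) : ℕ → E → Measure E
  | 0, θ => Measure.dirac θ
  | s + 1, θ => (dpsgdRun q σ C η b g D s θ).bind (dpsgdStep q σ C η b g D)

/-- The first `R` communication rounds on the client datasets `D i`, started at the global
parameters `θ₀`. The outcome consists of the parameters that every client has uploaded in every
round, and of the current global parameters. In each round all clients start from the global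
parameters, run DP-SGD locally with independent randomness and upload the result; the server takes
the weighted average. -/
def fedAvgRun {n : ℕ} (cfg : FedConfig n) (g : Z → E → E) (θ₀ : E) (D : Fin n → Finset Z) :
    (R : ℕ) → Measure ((Fin R → Fin n → E) × E)
  | 0 => Measure.dirac (Fin.elim0, θ₀)
  | R + 1 => (fedAvgRun cfg g θ₀ D R).bind fun p =>
      (Measure.pi fun i =>
        dpsgdRun cfg.q cfg.σ cfg.C cfg.η (cfg.batch i) g (D i) cfg.localSteps p.2).map
        fun u => (Fin.snoc p.1 u, ∑ i, cfg.weight i • u i)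

/-- Federated training on the global dataset `D`, split into the disjoint client datasets
`{z ∈ D | owner z = i}`. The output consists of all the uploads and of the final parameters. -/
def fedTrain {n : ℕ} (cfg : FedConfig n) (g : Z → E → E) (θ₀ : E) (owner : Z → Fin n)
    (D : Finset Z) : Measure ((Fin cfg.rounds → Fin n → E) × E) :=
  fedAvgRun cfg g θ₀ (fun i => D.filter fun z => owner z = i) cfg.rounds

/-- As `fedTrain`, but only the final parameters are published. -/
def fedTrainFinal {n : ℕ} (cfg : FedConfig n) (g : Z → E → E) (θ₀ : E) (owner : Z → Fin n)
    (D : Finset Z) : Measure E :=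
  (fedTrain cfg g θ₀ owner D).map Prod.snd

end Training

/-! ### LoRA and FFA-LoRA -/

section LoRA

variable {L : ℕ} {d k : Fin L → ℕ} {r : ℕ}

/-- The weight matrices of the adapted layers: the layer `l` has a `d l × k l` matrix. -/
abbrev Weights {L : ℕ} (d k : Fin L → ℕ) : Type :=
  (l : Fin L) → Matrix (Fin (d l)) (Fin (k l)) ℝ

/-- The entries of the low-rank factors `B l`, of size `d l × r`. -/
abbrev BIndex {L : ℕ} (d : Fin L → ℕ) (r : ℕ) : Type := (l : Fin L) × (Fin (d l) × Fin r)

/-- The entries of the low-rank factors `A l`, of size `r × k l`. -/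
abbrev AIndex {L : ℕ} (k : Fin L → ℕ) (r : ℕ) : Type := (l : Fin L) × (Fin r × Fin (k l))

/-- The trainable parameters of LoRA: all the entries of all the `B l` and `A l`. -/
abbrev LoRAParams {L : ℕ} (d k : Fin L → ℕ) (r : ℕ) : Type :=
  EuclideanSpace ℝ (BIndex d r ⊕ AIndex k r)

/-- The trainable parameters of FFA-LoRA: all the entries of all the `B l`. -/
abbrev FFAParams {L : ℕ} (d : Fin L → ℕ) (r : ℕ) : Type := EuclideanSpace ℝ (BIndex d r)

/-- The adapted weights `W = W₀ + (α / r) B A`, layer by layer. -/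
def adaptedWeights (W₀ : Weights d k) (α : ℝ) (B : (l : Fin L) → Matrix (Fin (d l)) (Fin r) ℝ)
    (A : (l : Fin L) → Matrix (Fin r) (Fin (k l)) ℝ) : Weights d k :=
  fun l => W₀ l + (α / r) • (B l * A l)

/-- The weights of the model in LoRA, where `A` and `B` are both trained. -/
def loraWeights (W₀ : Weights d k) (α : ℝ) (θ : LoRAParams d k r) : Weights d k :=
  adaptedWeights W₀ α (fun l => Matrix.of fun i j => θ (Sum.inl ⟨l, (i, j)⟩))
    (fun l => Matrix.of fun i j => θ (Sum.inr ⟨l, (i, j)⟩))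

/-- The weights of the model in FFA-LoRA, where `A = A₀` is frozen and only `B` is trained. -/
def ffaWeights (W₀ : Weights d k) (α : ℝ) (A₀ : (l : Fin L) → Matrix (Fin r) (Fin (k l)) ℝ)
    (θ : FFAParams d r) : Weights d k :=
  adaptedWeights W₀ α (fun l => Matrix.of fun i j => θ ⟨l, (i, j)⟩) A₀

/-- Per-sample gradient of the loss with respect to the trainable parameters of LoRA. -/
def loraGrad {Z : Type*} (loss : Z → Weights d k → ℝ) (W₀ : Weights d k) (α : ℝ) (z : Z)
    (θ : LoRAParams d k r) : LoRAParams d k r :=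
  gradient (fun θ' => loss z (loraWeights W₀ α θ')) θ

/-- Per-sample gradient of the loss with respect to the trainable parameters of FFA-LoRA. -/
def ffaGrad {Z : Type*} (loss : Z → Weights d k → ℝ) (W₀ : Weights d k) (α : ℝ)
    (A₀ : (l : Fin L) → Matrix (Fin r) (Fin (k l)) ℝ) (z : Z)
    (θ : FFAParams d r) : FFAParams d r :=
  gradient (fun θ' => loss z (ffaWeights W₀ α A₀ θ')) θ

end LoRA

end

open scoped RealInnerProductSpace

/-! Rényi accounting, phrased through `HolderDom`: with `p = m / (m - 1)`, the constant `M` controls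
the `L^m` norm of the density. Such constants multiply along adaptive composition
(`HolderDom.bind`), survive post-processing, and are not increased by independent coordinates with
equal laws (`HolderDom.pi`). Since a record belongs to one client, adding or removing it costs only
that client's `T` steps, however many clients there are.

For one step, condition on which of the other records enter the batch. The extra record then joins
with probability `q`, which replaces the noise `N(0, I)` by its mixture with a translate of length
at most `1 / σ` (`dpsgdStep_cons`). While `2 * m ≤ σ ^ 2`, the `m`-th moment of the mixture density
yields `M = exp (2 * q ^ 2 * m / σ ^ 2)`; the factor `q ^ 2` is amplification by subsampling
(`lintegral_mixDensity_pow_mul`). The reverse direction needs negative moments, which a reflection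
symmetry bounds by positive ones (`lintegral_inv_mixDensity_pow_le`).

A replacement is a removal followed by an addition, joined by `HolderDom.trans`.
`HolderDom.measure_le` converts the result to `(ε, δ)`, and `exists_moment_order` takes `m` of order
`log (1 / δ) / ε`. LoRA and FFA-LoRA enter only through measurability of their gradients, because
clipping bounds every record's influence. -/

noncomputable section

/-- Domination of `P` by `Q` in Hölder form. When `P` has a density with respect to `Q`, it bounds
the norm of the density in the Lebesgue space of the exponent conjugate to `p`, hence a Rényi
divergence. -/
def HolderDom {Ω : Type*} [MeasurableSpace Ω] (p : ℝ) (M : ENNReal) (P Q : Measure Ω) : Prop :=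
  ∀ f : Ω → ENNReal, Measurable f → ∫⁻ x, f x ∂P ≤ M * (∫⁻ x, f x ^ p ∂Q) ^ (1 / p)

/-! ### Calculus of Hölder domination -/

namespace HolderDom

variable {Ω Ω' : Type*} [MeasurableSpace Ω] [MeasurableSpace Ω'] {p p₂ : ℝ} {M M' : ENNReal}

theorem refl (hp : 1 ≤ p) (P : Measure Ω) [IsProbabilityMeasure P] : HolderDom p 1 P P := by
  intro f hf
  rcases hp.eq_or_lt with rfl | hp
  · simp
  have h := ENNReal.lintegral_mul_le_Lp_mul_Lq P (Real.HolderConjugate.conjExponent hp)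
    hf.aemeasurable (aemeasurable_const (b := 1))
  simpa using h

theorem mono {P Q : Measure Ω} (h : HolderDom p M P Q) (hM : M ≤ M') : HolderDom p M' P Q :=
  fun f hf => (h f hf).trans (by gcongr)

/-- A weak triangle inequality: the exponents multiply, so chaining two comparisons loses some
order. -/
theorem trans {P Q U : Measure Ω} (hp : 0 < p) (h : HolderDom p M P Q)
    (h' : HolderDom p₂ M' Q U) : HolderDom (p * p₂) (M * M' ^ (1 / p)) P U := by
  intro f hf
  refine (h f hf).trans ?_
  have h2 := h' (fun x => f x ^ p) (hf.pow_const p)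
  calc M * (∫⁻ x, f x ^ p ∂Q) ^ (1 / p)
      ≤ M * (M' * (∫⁻ x, (f x ^ p) ^ p₂ ∂U) ^ (1 / p₂)) ^ (1 / p) := by gcongr
    _ = _ := by
      rw [ENNReal.mul_rpow_of_nonneg _ _ (by positivity), ← ENNReal.rpow_mul, mul_assoc]
      simp_rw [← ENNReal.rpow_mul]
      congr 3
      field_simp

/-- Adaptive composition. The inner bound produces a `1 / p`-th power, which the outer bound raises
back to the power `p`, so the exponent is unchanged. -/
theorem bind {P Q : Measure Ω} {κ κ' : Ω → Measure Ω'} (hp : 0 < p) (h : HolderDom p M P Q)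
    (hκ : Measurable κ) (hκ' : Measurable κ') (h' : ∀ x, HolderDom p M' (κ x) (κ' x)) :
    HolderDom p (M * M') (P.bind κ) (Q.bind κ') := by
  intro f hf
  have hm : Measurable fun x => ∫⁻ y, f y ^ p ∂κ' x :=
    (Measure.measurable_lintegral (hf.pow_const p)).comp hκ'
  rw [Measure.lintegral_bind hκ.aemeasurable hf.aemeasurable,
    Measure.lintegral_bind hκ'.aemeasurable (hf.pow_const p).aemeasurable]
  calc ∫⁻ x, ∫⁻ y, f y ∂κ x ∂P
      ≤ ∫⁻ x, M' * (∫⁻ y, f y ^ p ∂κ' x) ^ (1 / p) ∂P := lintegral_mono fun x => h' x f hf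
    _ = M' * ∫⁻ x, (∫⁻ y, f y ^ p ∂κ' x) ^ (1 / p) ∂P := lintegral_const_mul _ (hm.pow_const _)
    _ ≤ M' * (M * (∫⁻ x, ((∫⁻ y, f y ^ p ∂κ' x) ^ (1 / p)) ^ p ∂Q) ^ (1 / p)) := by
      gcongr
      exact h _ (hm.pow_const _)
    _ = _ := by
      simp_rw [← ENNReal.rpow_mul, one_div_mul_cancel hp.ne', ENNReal.rpow_one]
      ring

theorem map {P Q : Measure Ω} (h : HolderDom p M P Q) {F : Ω → Ω'} (hF : Measurable F) :
    HolderDom p M (P.map F) (Q.map F) := by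
  intro f hf
  rw [lintegral_map hf hF, lintegral_map (hf.pow_const p) hF]
  exact h _ (hf.comp hF)

theorem prod_right {P Q : Measure Ω} [SFinite P] [SFinite Q] (hp : 1 ≤ p) (h : HolderDom p M P Q)
    (R : Measure Ω') [IsProbabilityMeasure R] : HolderDom p M (P.prod R) (Q.prod R) := by
  have hm : Measurable fun x : Ω => R.map (Prod.mk x) := by
    exact Measurable.map_prodMk_left
  have := h.bind (by linarith) hm hm (M' := 1) fun x => by
    have := Measure.isProbabilityMeasure_map (μ := R) (f := Prod.mk x) (by fun_prop)
    exact refl hp _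
  simpa [Measure.prod] using this

theorem pi {ι : Type*} [Fintype ι] {X : ι → Type*} [∀ i, MeasurableSpace (X i)]
    (hp : 1 ≤ p) (j : ι) {P Q : (i : ι) → Measure (X i)} [∀ i, IsProbabilityMeasure (P i)]
    [∀ i, IsProbabilityMeasure (Q i)] (h : HolderDom p M (P j) (Q j))
    (hne : ∀ i, i ≠ j → P i = Q i) : HolderDom p M (Measure.pi P) (Measure.pi Q) := by
  classical
  have hmeas : Measurable fun x : X j × (∀ i, X i) => Function.update x.2 j x.1 := by
    refine measurable_pi_lambda _ fun i => ?_
    rcases eq_or_ne i j with rfl | hi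
    · simpa using measurable_fst
    · simp only [Function.update_of_ne hi]
      fun_prop
  -- Resampling coordinate `j` of a draw from `Measure.pi P` exhibits both products as images of `P
  -- j` or `Q j` times the same measure.
  have key : ∀ P Q : (i : ι) → Measure (X i), (∀ i, IsProbabilityMeasure (P i)) →
      (∀ i, IsProbabilityMeasure (Q i)) → (∀ i, i ≠ j → P i = Q i) →
      ((Q j).prod (Measure.pi P)).map (fun x => Function.update x.2 j x.1) = Measure.pi Q := by
    intro P Q _ _ hne
    refine (Measure.pi_eq fun s hs => ?_).symm
    rw [Measure.map_apply hmeas (MeasurableSet.univ_pi hs)]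
    have : (fun x : X j × (∀ i, X i) => Function.update x.2 j x.1) ⁻¹' Set.univ.pi s =
        s j ×ˢ Set.univ.pi (Function.update s j Set.univ) := by
      ext x
      simp only [Set.mem_preimage, Set.mem_pi, Set.mem_univ, true_implies, Set.mem_prod]
      constructor
      · intro hx
        refine ⟨by simpa using hx j, fun i => ?_⟩
        rcases eq_or_ne i j with rfl | hi
        · simp
        · simpa [Function.update_of_ne hi] using hx i
      · rintro ⟨h1, h2⟩ i
        rcases eq_or_ne i j with rfl | hi
        · simpa
        · simpa [Function.update_of_ne hi] using h2 i
    rw [this, Measure.prod_prod, Measure.pi_pi, ← Finset.mul_prod_erase _ _ (Finset.mem_univ j),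
      ← Finset.mul_prod_erase _ _ (Finset.mem_univ j)]
    simp only [Function.update_self, measure_univ, one_mul]
    congr 1
    refine Finset.prod_congr rfl fun i hi => ?_
    rw [Function.update_of_ne (Finset.ne_of_mem_erase hi), hne i (Finset.ne_of_mem_erase hi)]
  rw [← key P P inferInstance inferInstance fun _ _ => rfl, ← key P Q inferInstance inferInstance hne]
  exact (h.prod_right hp _).map hmeas

/-- Mixing with common weights costs nothing, by the power mean inequality. -/
theorem finset_sum {ι : Type*} {s : Finset ι} {w : ι → ENNReal} (hw : ∑ i ∈ s, w i = 1)
    {P Q : ι → Measure Ω} (hp : 1 ≤ p) (h : ∀ i, HolderDom p M (P i) (Q i)) :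
    HolderDom p M (∑ i ∈ s, w i • P i) (∑ i ∈ s, w i • Q i) := by
  intro f hf
  simp only [lintegral_finsetSum_measure, lintegral_smul_measure, smul_eq_mul]
  have hp0 : 0 < p := by linarith
  calc ∑ i ∈ s, w i * ∫⁻ x, f x ∂P i
      ≤ ∑ i ∈ s, w i * (M * (∫⁻ x, f x ^ p ∂Q i) ^ (1 / p)) := by
        gcongr with i
        exact h i f hf
    _ = M * ∑ i ∈ s, w i * (∫⁻ x, f x ^ p ∂Q i) ^ (1 / p) := by
        rw [Finset.mul_sum]
        exact Finset.sum_congr rfl fun i _ => by ring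
    _ ≤ _ := by
        gcongr
        rw [one_div, ENNReal.le_rpow_inv_iff hp0]
        simp only [← one_div]
        refine (ENNReal.rpow_arith_mean_le_arith_mean_rpow s w _ hw hp).trans_eq ?_
        simp_rw [← ENNReal.rpow_mul, one_div_mul_cancel hp0.ne', ENNReal.rpow_one]

/-- Hölder domination with exponents close to `1` implies approximate indistinguishability. -/
theorem measure_le {P Q : Measure Ω} {θ a ε δ : ℝ} (hθ : 0 < θ) (hθ1 : θ < 1)
    (h : HolderDom (1 / θ) (ENNReal.ofReal (Real.exp a)) P Q) (hδ : 0 < δ)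
    (ha : a ≤ ε * θ + (1 - θ) * Real.log δ) {S : Set Ω} (hS : MeasurableSet S) :
    P S ≤ ENNReal.ofReal (Real.exp ε) * Q S + ENNReal.ofReal δ := by
  have h1 := h (S.indicator 1) (measurable_one.indicator hS)
  have h2 : ∀ x, (S.indicator 1 x : ENNReal) ^ (1 / θ) = S.indicator 1 x := by
    intro x
    by_cases hx : x ∈ S <;> simp [hx, hθ]
  simp_rw [h2, lintegral_indicator_one hS, one_div_one_div] at h1
  refine h1.trans ?_
  -- The bound on `a` turns the right side into a weighted geometric mean of `exp ε * Q S` and `δ`,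
  -- which is at most their sum.
  calc ENNReal.ofReal (Real.exp a) * Q S ^ θ
      ≤ ENNReal.ofReal (Real.exp (ε * θ) * δ ^ (1 - θ)) * Q S ^ θ := by
        gcongr
        rw [Real.rpow_def_of_pos hδ, ← Real.exp_add]
        gcongr
        linarith
    _ = (ENNReal.ofReal (Real.exp ε) * Q S) ^ θ * (ENNReal.ofReal δ) ^ (1 - θ) := by
        rw [ENNReal.mul_rpow_of_nonneg _ _ hθ.le, ENNReal.ofReal_rpow_of_pos (Real.exp_pos _),
          ENNReal.ofReal_rpow_of_pos hδ, ENNReal.ofReal_mul (Real.exp_pos _).le, Real.exp_mul]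
        ring
    _ ≤ (ENNReal.ofReal (Real.exp ε) * Q S + ENNReal.ofReal δ) ^ θ *
        (ENNReal.ofReal (Real.exp ε) * Q S + ENNReal.ofReal δ) ^ (1 - θ) := by
        have : 0 ≤ 1 - θ := by linarith
        gcongr
        · exact le_self_add
        · exact le_add_self
    _ = _ := by
        rw [← ENNReal.rpow_add_of_nonneg _ _ hθ.le (by linarith)]
        simp

end HolderDom


/-! ### Translates of the standard Gaussian -/

section Gaussian

variable {E : Type*} [NormedAddCommGroup E] [InnerProductSpace ℝ E]

/-- The density of the standard Gaussian measure translated by `h` with respect to the standard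
Gaussian measure. -/
def shiftDensity (h x : E) : ℝ := Real.exp (⟪h, x⟫ - ‖h‖ ^ 2 / 2)

theorem shiftDensity_pos (h x : E) : 0 < shiftDensity h x := Real.exp_pos _

theorem inv_shiftDensity_add (h x : E) : (shiftDensity h (x + h))⁻¹ = shiftDensity h (-x) := by
  rw [shiftDensity, shiftDensity, ← Real.exp_neg, inner_add_right, real_inner_self_eq_norm_sq,
    inner_neg_right]
  ring_nf

variable [FiniteDimensional ℝ E] [MeasurableSpace E] [BorelSpace E]

@[fun_prop]
theorem measurable_shiftDensity (h : E) : Measurable (shiftDensity h) := by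
  unfold shiftDensity; fun_prop

open Complex in
-- Product structure in an orthonormal basis reduces this to the one-dimensional complex moment
-- generating function. The real tilt `s` beside the frequency `t` gives the characteristic function
-- of the tilted measure in the Cameron–Martin formula.
theorem integral_cexp_stdGaussian (s t : E) :
    ∫ x, cexp (⟪x, t⟫ * I + ⟪x, s⟫) ∂(stdGaussian E) =
      cexp ((‖s‖ ^ 2 - ‖t‖ ^ 2) / 2 + ⟪s, t⟫ * I) := by
  have h1 : ∀ z : ℂ, ∫ x : ℝ, cexp (z * x) ∂(gaussianReal 0 1) = cexp (z ^ 2 / 2) := by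
    intro z
    have := complexMGF_id_gaussianReal (μ := 0) (v := 1) z
    simpa [complexMGF] using this
  rw [stdGaussian, integral_map (Measurable.aemeasurable (by fun_prop))
    (Measurable.aestronglyMeasurable (by fun_prop))]
  have h2 : ∀ x : Fin (Module.finrank ℝ E) → ℝ,
      cexp (⟪∑ i, x i • stdOrthonormalBasis ℝ E i, t⟫ * I
        + ⟪∑ i, x i • stdOrthonormalBasis ℝ E i, s⟫) =
      ∏ i, cexp ((⟪stdOrthonormalBasis ℝ E i, t⟫ * I + ⟪stdOrthonormalBasis ℝ E i, s⟫) * x i) := by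
    intro x
    rw [← Complex.exp_sum]
    simp only [sum_inner, ofReal_sum, Finset.sum_mul, ← Finset.sum_add_distrib,
      real_inner_smul_left, ofReal_mul]
    congr 1
    exact Finset.sum_congr rfl fun i _ => by ring
  simp_rw [h2]
  rw [integral_fintype_prod_eq_prod (f := fun i (x : ℝ) =>
    cexp ((⟪stdOrthonormalBasis ℝ E i, t⟫ * I + ⟪stdOrthonormalBasis ℝ E i, s⟫) * x))]
  simp_rw [h1, ← Complex.exp_sum]
  congr 1
  have e1 := (stdOrthonormalBasis ℝ E).sum_sq_inner_right s
  have e2 := (stdOrthonormalBasis ℝ E).sum_sq_inner_right t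
  have e3 := (stdOrthonormalBasis ℝ E).sum_inner_mul_inner s t
  rw [← ofReal_pow, ← ofReal_pow, ← e1, ← e2, ← e3]
  push_cast
  rw [Finset.sum_mul, ← Finset.sum_sub_distrib, Finset.sum_div, ← Finset.sum_add_distrib]
  refine Finset.sum_congr rfl fun i _ => ?_
  rw [real_inner_comm s]
  linear_combination (⟪stdOrthonormalBasis ℝ E i, t⟫ : ℂ) ^ 2 / 2 * I_sq

theorem lintegral_shiftDensity (h : E) :
    ∫⁻ x, ENNReal.ofReal (shiftDensity h x) ∂(stdGaussian E) = 1 := by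
  have h1 := integral_cexp_stdGaussian h 0
  have e1 : ∀ x : E, Complex.exp (⟪x, (0 : E)⟫ * Complex.I + ⟪x, h⟫) =
      ((Real.exp (‖h‖ ^ 2 / 2) * shiftDensity h x : ℝ) : ℂ) := by
    intro x
    rw [shiftDensity, ← Real.exp_add, Complex.ofReal_exp, real_inner_comm]
    simp [real_inner_comm]
  simp_rw [e1] at h1
  rw [integral_complex_ofReal, integral_const_mul] at h1
  have h2 : ∫ x, shiftDensity h x ∂(stdGaussian E) = 1 := by
    have h3 : ((Real.exp (‖h‖ ^ 2 / 2) * ∫ x, shiftDensity h x ∂(stdGaussian E) : ℝ) : ℂ) =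
        ((Real.exp (‖h‖ ^ 2 / 2) : ℝ) : ℂ) := by
      rw [h1, Complex.ofReal_exp]
      simp
    simpa [Real.exp_ne_zero] using Complex.ofReal_injective h3
  rw [← ofReal_integral_eq_lintegral_ofReal
    (Integrable.of_integral_ne_zero (by rw [h2]; exact one_ne_zero))
    (Filter.Eventually.of_forall fun x => (shiftDensity_pos h x).le), h2, ENNReal.ofReal_one]

/-- The Cameron–Martin formula. -/
theorem withDensity_shiftDensity (h : E) :
    (stdGaussian E).withDensity (fun x => ENNReal.ofReal (shiftDensity h x)) =
      (stdGaussian E).map (· + h) := by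
  have : IsFiniteMeasure ((stdGaussian E).withDensity
      (fun x => ENNReal.ofReal (shiftDensity h x))) :=
    isFiniteMeasure_withDensity (by rw [lintegral_shiftDensity]; simp)
  refine Measure.ext_of_charFun ?_
  ext t
  rw [charFun_apply, charFun_apply, integral_withDensity_eq_integral_toReal_smul (by fun_prop)
    (by simp), integral_map (by fun_prop) (Measurable.aestronglyMeasurable (by fun_prop))]
  have e1 : ∀ x : E, (ENNReal.ofReal (shiftDensity h x)).toReal • Complex.exp (⟪x, t⟫ * Complex.I)
      = Complex.exp (-‖h‖ ^ 2 / 2) * Complex.exp (⟪x, t⟫ * Complex.I + ⟪x, h⟫) := by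
    intro x
    rw [ENNReal.toReal_ofReal (shiftDensity_pos h x).le, shiftDensity, Complex.real_smul,
      ← Complex.exp_add, Complex.ofReal_exp, ← Complex.exp_add, real_inner_comm]
    push_cast
    ring_nf
  have e2 : ∀ x : E, Complex.exp (⟪x + h, t⟫ * Complex.I) =
      Complex.exp (⟪h, t⟫ * Complex.I) * Complex.exp (⟪x, t⟫ * Complex.I + ⟪x, (0 : E)⟫) := by
    intro x
    rw [← Complex.exp_add, inner_add_left]
    push_cast
    simp
    ring_nf
  simp_rw [e1, e2]
  rw [integral_const_mul, integral_const_mul, integral_cexp_stdGaussian,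
    integral_cexp_stdGaussian, ← Complex.exp_add, ← Complex.exp_add]
  simp
  ring_nf

theorem lintegral_add_stdGaussian (h : E) {f : E → ENNReal} (hf : Measurable f) :
    ∫⁻ x, f (x + h) ∂(stdGaussian E) =
      ∫⁻ x, ENNReal.ofReal (shiftDensity h x) * f x ∂(stdGaussian E) := by
  rw [← lintegral_map hf (by fun_prop : Measurable (· + h)), ← withDensity_shiftDensity,
    lintegral_withDensity_eq_lintegral_mul _ (by fun_prop) hf]
  rfl

theorem lintegral_neg_stdGaussian {f : E → ENNReal} (hf : Measurable f) :
    ∫⁻ x, f (-x) ∂(stdGaussian E) = ∫⁻ x, f x ∂(stdGaussian E) := by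
  conv_rhs => rw [← stdGaussian_map (LinearIsometryEquiv.neg ℝ (E := E))]
  rw [lintegral_map hf (by fun_prop)]
  rfl

end Gaussian

/-! ### Elementary inequality behind the reverse moment bound -/

theorem add_inv_le_add_inv {x y : ℝ} (hx : 1 ≤ x) (hxy : x ≤ y) : x + x⁻¹ ≤ y + y⁻¹ := by
  have hx0 : 0 < x := by linarith
  have hy0 : 0 < y := by linarith
  have h : y + y⁻¹ - (x + x⁻¹) = (y - x) * (x * y - 1) / (x * y) := by
    field_simp
    ring
  have : 0 ≤ (y - x) * (x * y - 1) / (x * y) := by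
    have h1 : 0 ≤ x * y - 1 := by nlinarith
    have h2 : 0 ≤ y - x := by linarith
    positivity
  linarith

/-- Equality holds at `m = 0`. Passing from `m` to `m + 1`, the gap grows by the product in `key`,
whose factors agree in sign: `a * b ≥ 1` puts `a` and `b` on opposite sides of `1` with the larger
dominating the inverse of the other, and `y + y⁻¹` increases on `[1, ∞)`. -/
theorem inv_pow_add_le_pow_add {a b z : ℝ} (ha : 0 < a) (hb : 0 < b) (hz : 0 < z)
    (hab : 1 ≤ a * b) (h : a - 1 = z * (1 - b)) (m : ℕ) :
    (a⁻¹) ^ m + z * (b⁻¹) ^ m ≤ a ^ (m + 1) + z * b ^ (m + 1) := by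
  induction m with
  | zero => simp; linarith
  | succ m ih =>
    have key : 0 ≤ (a - 1) * ((a ^ (m + 1) + (a⁻¹) ^ (m + 1)) - (b ^ (m + 1) + (b⁻¹) ^ (m + 1))) := by
      rcases le_total 1 a with h1 | h1
      · have hb1 : b ≤ 1 := by
          by_contra! hb1
          nlinarith
        have h2 : (b⁻¹) ^ (m + 1) ≤ a ^ (m + 1) := by
          gcongr
          rwa [inv_le_iff_one_le_mul₀ hb]
        have h3 := add_inv_le_add_inv (one_le_pow₀ ((one_le_inv₀ hb).2 hb1)) h2
        simp only [inv_pow, inv_inv] at h3 ⊢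
        exact mul_nonneg (by linarith) (by linarith)
      · have h2 : (a⁻¹) ^ (m + 1) ≤ b ^ (m + 1) := by
          gcongr
          rwa [inv_le_iff_one_le_mul₀ ha, mul_comm]
        have h3 := add_inv_le_add_inv (one_le_pow₀ ((one_le_inv₀ ha).2 h1)) h2
        simp only [inv_pow, inv_inv] at h3 ⊢
        exact mul_nonneg_of_nonpos_of_nonpos (by linarith) (by linarith)
    have ea : (a - 1) * (a⁻¹) ^ (m + 1) = (a⁻¹) ^ m - (a⁻¹) ^ (m + 1) := by
      rw [pow_succ]; field_simp
    have eb : (1 - b) * (b⁻¹) ^ (m + 1) = (b⁻¹) ^ (m + 1) - (b⁻¹) ^ m := by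
      rw [pow_succ]; field_simp
    have e1 : (a - 1) * (b⁻¹) ^ (m + 1) = z * ((b⁻¹) ^ (m + 1) - (b⁻¹) ^ m) := by
      rw [h, mul_assoc, eb]
    have e2 : (a - 1) * b ^ (m + 1) = z * (b ^ (m + 1) - b ^ (m + 2)) := by
      rw [h]; ring
    have e3 : (a - 1) * a ^ (m + 1) = a ^ (m + 2) - a ^ (m + 1) := by ring
    linarith

/-! ### Moments of the subsampled Gaussian mechanism -/

section SubsampledGaussian

variable {E : Type*} [NormedAddCommGroup E] [InnerProductSpace ℝ E]

/-- The density of the mixture of the standard Gaussian measure with its translate by `h`, with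
weights `1 - q` and `q`. -/
def mixDensity (q : ℝ) (h x : E) : ℝ := 1 - q + q * shiftDensity h x

theorem mixDensity_pos {q : ℝ} (hq : 0 ≤ q) (hq1 : q ≤ 1) (h x : E) : 0 < mixDensity q h x := by
  have := shiftDensity_pos h x
  rcases hq1.eq_or_lt with rfl | hq1
  · simpa [mixDensity]
  · have : 0 < 1 - q := by linarith
    unfold mixDensity
    positivity

variable [FiniteDimensional ℝ E] [MeasurableSpace E] [BorelSpace E]

@[fun_prop]
theorem measurable_mixDensity (q : ℝ) (h : E) : Measurable (mixDensity q h) := by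
  unfold mixDensity; fun_prop

theorem lintegral_shiftDensity_pow (h : E) (k : ℕ) :
    ∫⁻ x, ENNReal.ofReal (shiftDensity h x ^ k) ∂(stdGaussian E) =
      ENNReal.ofReal (Real.exp (‖h‖ ^ 2 / 2 * (k * (k - 1)))) := by
  have e : ∀ x, shiftDensity h x ^ k =
      Real.exp (‖h‖ ^ 2 / 2 * (k * (k - 1))) * shiftDensity ((k : ℝ) • h) x := by
    intro x
    rw [shiftDensity, shiftDensity, ← Real.exp_nat_mul, ← Real.exp_add, norm_smul,
      real_inner_smul_left, mul_pow, Real.norm_eq_abs, sq_abs]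
    ring_nf
  simp_rw [e, ENNReal.ofReal_mul (Real.exp_pos _).le]
  rw [lintegral_const_mul _ (by fun_prop), lintegral_shiftDensity, mul_one]

/-- The powers of `shiftDensity` make the induction close: expanding one mixture factor trades it,
with probability `q`, for a shift factor. The smallness condition depends only on `m + k`, so the
trade preserves it. -/
theorem lintegral_mixDensity_pow_mul {q : ℝ} (hq : 0 ≤ q) (hq1 : q ≤ 1) (h : E) {t : ℝ}
    (ht : t = ‖h‖ ^ 2 / 2) (m : ℕ) : ∀ k : ℕ, 4 * t * (m + k) ≤ 1 →
    ∫⁻ x, ENNReal.ofReal (mixDensity q h x ^ m * shiftDensity h x ^ k) ∂(stdGaussian E) ≤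
      ENNReal.ofReal (Real.exp
        (t * (k * (k - 1)) + 4 * q * t * k * m + 4 * q ^ 2 * t * (m * (m - 1)))) := by
  have ht0 : 0 ≤ t := by rw [ht]; positivity
  induction m with
  | zero =>
    intro k _
    simp [lintegral_shiftDensity_pow, ht]
  | succ m ih =>
    intro k hk
    push_cast at hk
    have h0 := ih k (by nlinarith)
    have h1 := ih (k + 1) (by push_cast; linarith)
    have e : ∀ x, ENNReal.ofReal (mixDensity q h x ^ (m + 1) * shiftDensity h x ^ k) =
        ENNReal.ofReal (1 - q) * ENNReal.ofReal (mixDensity q h x ^ m * shiftDensity h x ^ k) +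
        ENNReal.ofReal q *
          ENNReal.ofReal (mixDensity q h x ^ m * shiftDensity h x ^ (k + 1)) := by
      intro x
      have := (mixDensity_pos hq hq1 h x).le
      have := (shiftDensity_pos h x).le
      rw [← ENNReal.ofReal_mul (by linarith), ← ENNReal.ofReal_mul hq,
        ← ENNReal.ofReal_add (mul_nonneg (by linarith) (by positivity)) (by positivity),
        pow_succ, mixDensity]
      ring_nf
    simp_rw [e]
    rw [lintegral_add_left (by fun_prop), lintegral_const_mul _ (by fun_prop),
      lintegral_const_mul _ (by fun_prop)]
    refine (add_le_add (mul_le_mul_right h0 _) (mul_le_mul_right h1 _)).trans ?_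
    rw [← ENNReal.ofReal_mul (by linarith), ← ENNReal.ofReal_mul hq,
      ← ENNReal.ofReal_add (mul_nonneg (by linarith) (Real.exp_pos _).le) (by positivity)]
    refine ENNReal.ofReal_le_ofReal ?_
    set B := t * (k * (k - 1)) + 4 * q * t * k * m + 4 * q ^ 2 * t * (m * (m - 1)) with hB
    -- `x` is the growth of the exponent when `k` increases by one; increasing `m` instead adds `2 *
    -- q * x`. What remains is `1 - q + q * exp x ≤ exp (2 * q * x)`, from `exp x ≤ 1 + 2 * x` on
    -- `[0, 1]`.
    set x := 2 * t * k + 4 * q * t * m with hx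
    have hx0 : 0 ≤ x := by positivity
    have hx1 : x ≤ 1 := by
      have : q * (4 * t * m) ≤ 1 * (4 * t * m) := by gcongr
      have : 0 ≤ t * k := by positivity
      nlinarith
    have hexp : Real.exp x ≤ 1 + 2 * x := by
      have := Real.abs_exp_sub_one_le (x := x) (by rwa [abs_of_nonneg hx0])
      rw [abs_of_nonneg hx0] at this
      linarith [le_abs_self (Real.exp x - 1)]
    have e1 : t * (((k + 1 : ℕ) : ℝ) * ((k + 1 : ℕ) - 1)) + 4 * q * t * ((k + 1 : ℕ) : ℝ) * m
        + 4 * q ^ 2 * t * (m * (m - 1)) = B + x := by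
      push_cast; rw [hB, hx]; ring
    have e2 : t * (k * (k - 1)) + 4 * q * t * k * ((m + 1 : ℕ) : ℝ)
        + 4 * q ^ 2 * t * (((m + 1 : ℕ) : ℝ) * ((m + 1 : ℕ) - 1)) = B + q * (2 * x) := by
      push_cast; rw [hB, hx]; ring
    rw [e1, e2, Real.exp_add B x, Real.exp_add B (q * (2 * x))]
    have h3 := Real.add_one_le_exp (q * (2 * x))
    have h4 : q * Real.exp x ≤ q * (1 + 2 * x) := by gcongr
    nlinarith [Real.exp_pos B]

theorem lintegral_mixDensity_pow {q : ℝ} (hq : 0 ≤ q) (hq1 : q ≤ 1) (h : E) (m : ℕ)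
    (hm : 2 * ‖h‖ ^ 2 * m ≤ 1) :
    ∫⁻ x, ENNReal.ofReal (mixDensity q h x ^ m) ∂(stdGaussian E) ≤
      ENNReal.ofReal (Real.exp (2 * q ^ 2 * ‖h‖ ^ 2 * m ^ 2)) := by
  have := lintegral_mixDensity_pow_mul hq hq1 h rfl m 0 (by push_cast; linarith)
  simp only [pow_zero, mul_one] at this
  refine this.trans (ENNReal.ofReal_le_ofReal (Real.exp_le_exp.2 ?_))
  have h1 : 0 ≤ q ^ 2 * ‖h‖ ^ 2 * m := by positivity
  simp
  nlinarith

/-- The reflection `x ↦ h - x` exchanges the Gaussian with its translate and inverts the density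
between them. -/
theorem lintegral_comp_mixDensity (q : ℝ) (h : E) {F : ℝ → ENNReal} (hF : Measurable F) :
    ∫⁻ x, F (mixDensity q h x) ∂(stdGaussian E) =
      ∫⁻ x, ENNReal.ofReal (shiftDensity h x) * F (1 - q + q * (shiftDensity h x)⁻¹)
        ∂(stdGaussian E) := by
  rw [← lintegral_add_stdGaussian h (f := fun x => F (1 - q + q * (shiftDensity h x)⁻¹))
    (by fun_prop)]
  simp_rw [inv_shiftDensity_add]
  rw [lintegral_neg_stdGaussian (f := fun x => F (1 - q + q * shiftDensity h x)) (by fun_prop)]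
  rfl

theorem lintegral_inv_mixDensity_pow_le {q : ℝ} (hq : 0 ≤ q) (hq1 : q ≤ 1) (h : E) (m : ℕ) :
    ∫⁻ x, ENNReal.ofReal ((mixDensity q h x)⁻¹ ^ m) ∂(stdGaussian E) ≤
      ∫⁻ x, ENNReal.ofReal (mixDensity q h x ^ (m + 1)) ∂(stdGaussian E) := by
  have e1 := lintegral_comp_mixDensity q h (F := fun y => ENNReal.ofReal (y⁻¹ ^ m)) (by fun_prop)
  have e2 := lintegral_comp_mixDensity q h (F := fun y => ENNReal.ofReal (y ^ (m + 1)))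
    (by fun_prop)
  -- The pointwise inequality can fail for either form of the integral alone; it holds after adding
  -- each integrand to its reflected form.
  rw [← ENNReal.mul_le_mul_iff_right (a := 2) (by simp) (by simp), two_mul, two_mul]
  nth_rewrite 2 [e1]
  nth_rewrite 2 [e2]
  rw [← lintegral_add_left (by fun_prop), ← lintegral_add_left (by fun_prop)]
  refine lintegral_mono fun x => ?_
  have hz := shiftDensity_pos h x
  have ha := mixDensity_pos hq hq1 h x
  set z := shiftDensity h x
  have hb : 0 < 1 - q + q * z⁻¹ := by
    have := mixDensity_pos hq hq1 h (-(x - h))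
    rwa [mixDensity, ← inv_shiftDensity_add, sub_add_cancel] at this
  have hab : 1 ≤ mixDensity q h x * (1 - q + q * z⁻¹) := by
    have e : mixDensity q h x * (1 - q + q * z⁻¹) = 1 + q * (1 - q) * ((z - 1) ^ 2 * z⁻¹) := by
      simp only [mixDensity]
      field_simp
      ring
    have : 0 ≤ q * (1 - q) * ((z - 1) ^ 2 * z⁻¹) :=
      mul_nonneg (mul_nonneg hq (by linarith)) (by positivity)
    linarith
  have key := inv_pow_add_le_pow_add ha hb hz hab (by
    simp only [mixDensity]
    field_simp
    ring) m
  rw [← ENNReal.ofReal_mul hz.le, ← ENNReal.ofReal_mul hz.le,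
    ← ENNReal.ofReal_add (by positivity) (by positivity),
    ← ENNReal.ofReal_add (by positivity) (by positivity)]
  exact ENNReal.ofReal_le_ofReal key

/-- The standard Gaussian measure mixed with its translate by `h`. -/
def gaussianMix (q : ℝ) (h : E) : Measure E :=
  ENNReal.ofReal (1 - q) • stdGaussian E + ENNReal.ofReal q • (stdGaussian E).map (· + h)

theorem lintegral_gaussianMix {q : ℝ} (hq : 0 ≤ q) (hq1 : q ≤ 1) (h : E) {f : E → ENNReal}
    (hf : Measurable f) : ∫⁻ x, f x ∂(gaussianMix q h) =
      ∫⁻ x, ENNReal.ofReal (mixDensity q h x) * f x ∂(stdGaussian E) := by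
  rw [gaussianMix, lintegral_add_measure, lintegral_smul_measure, lintegral_smul_measure,
    lintegral_map hf (by fun_prop), lintegral_add_stdGaussian h hf, smul_eq_mul, smul_eq_mul,
    ← lintegral_const_mul _ hf, ← lintegral_const_mul _ (by fun_prop),
    ← lintegral_add_left (by fun_prop)]
  refine lintegral_congr fun x => ?_
  rw [mixDensity, ENNReal.ofReal_add (by linarith) (mul_nonneg hq (shiftDensity_pos h x).le),
    ENNReal.ofReal_mul hq]
  ring

theorem rpow_lintegral_mixDensity_le {q : ℝ} (hq : 0 ≤ q) (hq1 : q ≤ 1) (h : E) {m : ℕ}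
    (hm0 : 0 < m) (hm : 2 * ‖h‖ ^ 2 * m ≤ 1) :
    (∫⁻ x, ENNReal.ofReal (mixDensity q h x ^ m) ∂(stdGaussian E)) ^ (1 / (m : ℝ)) ≤
      ENNReal.ofReal (Real.exp (2 * q ^ 2 * ‖h‖ ^ 2 * m)) := by
  have hm0 : (0 : ℝ) < m := by exact_mod_cast hm0
  calc _ ≤ ENNReal.ofReal (Real.exp (2 * q ^ 2 * ‖h‖ ^ 2 * m ^ 2)) ^ (1 / (m : ℝ)) := by
        gcongr
        exact lintegral_mixDensity_pow hq hq1 h m hm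
    _ = _ := by
        rw [ENNReal.ofReal_rpow_of_pos (Real.exp_pos _), ← Real.exp_mul]
        congr 2
        field_simp

theorem holderConjugate_nat {m : ℕ} (hm : 2 ≤ m) :
    (m : ℝ).HolderConjugate ((m : ℝ) / (m - 1)) :=
  Real.HolderConjugate.conjExponent (by exact_mod_cast hm)

theorem holderDom_gaussianMix {q : ℝ} (hq : 0 ≤ q) (hq1 : q ≤ 1) (h : E) {m : ℕ}
    (hm2 : 2 ≤ m) (hm : 2 * ‖h‖ ^ 2 * m ≤ 1) :
    HolderDom (m / (m - 1)) (ENNReal.ofReal (Real.exp (2 * q ^ 2 * ‖h‖ ^ 2 * m)))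
      (gaussianMix q h) (stdGaussian E) := by
  intro f hf
  rw [lintegral_gaussianMix hq hq1 h hf]
  refine (ENNReal.lintegral_mul_le_Lp_mul_Lq _ (holderConjugate_nat hm2)
    (by fun_prop) hf.aemeasurable).trans ?_
  gcongr
  refine le_trans (le_of_eq ?_) (rpow_lintegral_mixDensity_le hq hq1 h (by omega) hm)
  congr 1
  refine lintegral_congr fun x => ?_
  rw [ENNReal.rpow_natCast, ENNReal.ofReal_pow (mixDensity_pos hq hq1 h x).le]

theorem holderDom_stdGaussian {q : ℝ} (hq : 0 ≤ q) (hq1 : q ≤ 1) (h : E) {m : ℕ}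
    (hm2 : 2 ≤ m) (hm : 2 * ‖h‖ ^ 2 * m ≤ 1) :
    HolderDom (m / (m - 1)) (ENNReal.ofReal (Real.exp (2 * q ^ 2 * ‖h‖ ^ 2 * m)))
      (stdGaussian E) (gaussianMix q h) := by
  intro f hf
  have hpq := holderConjugate_nat hm2
  set p : ℝ := m / (m - 1) with hp
  have hm2' : (2 : ℝ) ≤ m := by exact_mod_cast hm2
  have hp0 : 0 < p := hpq.symm.pos
  rw [lintegral_gaussianMix hq hq1 h (hf.pow_const p)]
  -- The split makes the second Hölder factor an integral against the mixture. As `m / p = m - 1`,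
  -- the first involves the negative moment of order `m - 1`, bounded by the positive one of order
  -- `m`.
  have e1 : ∀ x, f x = ENNReal.ofReal (mixDensity q h x) ^ (-(1 / p)) *
      (ENNReal.ofReal (mixDensity q h x) ^ (1 / p) * f x) := by
    intro x
    have := mixDensity_pos hq hq1 h x
    rw [← mul_assoc, ← ENNReal.rpow_add _ _ (by simpa) (by simp), neg_add_cancel,
      ENNReal.rpow_zero, one_mul]
  calc ∫⁻ x, f x ∂(stdGaussian E)
      = ∫⁻ x, ENNReal.ofReal (mixDensity q h x) ^ (-(1 / p)) *
          (ENNReal.ofReal (mixDensity q h x) ^ (1 / p) * f x) ∂(stdGaussian E) :=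
        lintegral_congr e1
    _ ≤ _ := ENNReal.lintegral_mul_le_Lp_mul_Lq _ hpq (by fun_prop) (by fun_prop)
    _ ≤ _ := ?_
  gcongr ?_ * ?_
  · refine le_trans ?_ (rpow_lintegral_mixDensity_le hq hq1 h (by omega) hm)
    have := lintegral_inv_mixDensity_pow_le hq hq1 h (m - 1)
    rw [Nat.sub_add_cancel (by omega)] at this
    refine ENNReal.rpow_le_rpow (le_trans (le_of_eq ?_) this) (by positivity)
    refine lintegral_congr fun x => ?_
    have hx := mixDensity_pos hq hq1 h x
    rw [← ENNReal.rpow_mul, ENNReal.ofReal_rpow_of_pos hx]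
    congr 1
    have : -(1 / p) * m = -((m - 1 : ℕ) : ℝ) := by
      rw [Nat.cast_sub (by omega), hp]
      push_cast
      field_simp
    rw [this, Real.rpow_neg hx.le, Real.rpow_natCast, inv_pow]
  · refine le_of_eq ?_
    congr 1
    refine lintegral_congr fun x => ?_
    rw [ENNReal.mul_rpow_of_nonneg _ _ hp0.le, ← ENNReal.rpow_mul, one_div_mul_cancel hp0.ne',
      ENNReal.rpow_one]

end SubsampledGaussian

/-! ### DP-SGD steps, local runs and federated rounds -/

theorem norm_clip_le {E : Type*} [NormedAddCommGroup E] [NormedSpace ℝ E] {C : ℝ} (hC : 0 < C)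
    (g : E) : ‖clip C g‖ ≤ C := by
  have h1 : 0 < max 1 (‖g‖ / C) := lt_of_lt_of_le one_pos (le_max_left _ _)
  rw [clip, norm_smul, norm_inv, Real.norm_of_nonneg h1.le, inv_mul_le_iff₀ h1]
  calc ‖g‖ = ‖g‖ / C * C := by field_simp
    _ ≤ _ := by gcongr; exact le_max_right _ _

theorem measurable_measure_pi {A ι : Type*} [MeasurableSpace A] [Fintype ι] {X : ι → Type*}
    [∀ i, MeasurableSpace (X i)] {κ : (i : ι) → A → Measure (X i)}
    [∀ i a, IsProbabilityMeasure (κ i a)] (hκ : ∀ i, Measurable (κ i)) :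
    Measurable fun a => Measure.pi fun i => κ i a := by
  refine .measure_of_isPiSystem_of_isProbabilityMeasure generateFrom_pi.symm isPiSystem_pi ?_
  rintro _ ⟨s, hs, rfl⟩
  simp_rw [Measure.pi_pi]
  exact Finset.measurable_fun_prod _ fun i _ =>
    (Measure.measurable_coe (hs i (Set.mem_univ i))).comp (hκ i)

theorem measurable_map_of_uncurry {A X Y : Type*} [MeasurableSpace A] [MeasurableSpace X]
    [MeasurableSpace Y] {κ : A → Measure X} [∀ a, IsProbabilityMeasure (κ a)] (hκ : Measurable κ)
    {F : A → X → Y} (hF : Measurable (Function.uncurry F)) :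
    Measurable fun a => (κ a).map (F a) := by
  refine Measure.measurable_of_measurable_coe _ fun s hs => ?_
  let κ' : Kernel A X := ⟨κ, hκ⟩
  have : IsMarkovKernel κ' := ⟨fun a => inferInstanceAs (IsProbabilityMeasure (κ a))⟩
  have h := Kernel.measurable_kernel_prodMk_left (κ := κ') (hF hs)
  convert h with a
  exact Measure.map_apply (f := F a) (hF.comp measurable_prodMk_left) hs

section Training

variable {Z E : Type*} [NormedAddCommGroup E] [InnerProductSpace ℝ E] [FiniteDimensional ℝ E]
  [MeasurableSpace E] [BorelSpace E]

theorem measurable_clip (C : ℝ) : Measurable (clip C : E → E) := by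
  unfold clip
  fun_prop

theorem sum_batch_weight {q : ℝ} (hq : 0 ≤ q) (hq1 : q ≤ 1) (D : Finset Z) :
    ∑ S ∈ D.powerset, ENNReal.ofReal (q ^ S.card * (1 - q) ^ (D.card - S.card)) = 1 := by
  have : 0 ≤ 1 - q := by linarith
  rw [← ENNReal.ofReal_sum_of_nonneg fun S _ => by positivity, Finset.sum_pow_mul_eq_add_pow]
  simp

variable {q σ C η b : ℝ} {g : Z → E → E}

theorem isProbabilityMeasure_dpsgdStep (hq : 0 ≤ q) (hq1 : q ≤ 1) (D : Finset Z) (θ : E) :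
    IsProbabilityMeasure (dpsgdStep q σ C η b g D θ) := by
  refine ⟨?_⟩
  rw [dpsgdStep, Measure.finsetSum_apply, ← sum_batch_weight hq hq1 D]
  refine Finset.sum_congr rfl fun S _ => ?_
  rw [Measure.smul_apply, Measure.map_apply (by fun_prop) MeasurableSet.univ]
  simp

theorem measurable_dpsgdStep (hg : ∀ z, Measurable (g z)) (D : Finset Z) :
    Measurable (dpsgdStep q σ C η b g D) := by
  have hc := measurable_clip (E := E) C
  refine Measure.measurable_of_measurable_coe _ fun s hs => ?_
  simp only [dpsgdStep, Measure.finsetSum_apply, Measure.smul_apply, smul_eq_mul]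
  refine Finset.measurable_fun_sum _ fun S _ => Measurable.const_mul ?_ _
  refine (Measure.measurable_coe hs).comp
    (measurable_map_of_uncurry (κ := fun _ => stdGaussian E) measurable_const ?_)
  unfold Function.uncurry
  have : Measurable fun x : E × E => ∑ z ∈ S, clip C (g z x.1) :=
    Finset.measurable_fun_sum _ fun z _ => hc.comp ((hg z).comp measurable_fst)
  fun_prop

/-- Batches are paired according to whether they contain `z`; its clipped gradient is absorbed into
the noise as a translation. Both neighbours become mixtures with the same weights and the same maps.
-/
theorem dpsgdStep_cons (hq : 0 ≤ q) (hq1 : q ≤ 1) (hσ : 0 < σ) (hC : 0 < C) (D : Finset Z) (z : Z)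
    (hz : z ∉ D) (θ : E) :
    dpsgdStep q σ C η b g (D.cons z hz) θ =
      ∑ S ∈ D.powerset, ENNReal.ofReal (q ^ S.card * (1 - q) ^ (D.card - S.card)) •
        (gaussianMix q ((C * σ)⁻¹ • clip C (g z θ))).map fun ξ =>
          θ - η • (b⁻¹ • ((∑ z ∈ S, clip C (g z θ)) + (C * σ) • ξ)) := by
  classical
  have hq' : 0 ≤ 1 - q := by linarith
  rw [dpsgdStep, Finset.cons_eq_insert, Finset.sum_powerset_insert hz, ← Finset.sum_add_distrib]
  refine Finset.sum_congr rfl fun S hS => ?_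
  have hSD := Finset.mem_powerset.1 hS
  have hzS : z ∉ S := fun h => hz (hSD h)
  have hcard := Finset.card_le_card hSD
  rw [gaussianMix, Measure.map_add _ _ (by fun_prop), Measure.map_smul, Measure.map_smul,
    Measure.map_map (by fun_prop) (by fun_prop), smul_add, smul_smul, smul_smul,
    Finset.card_insert_of_notMem hz, Finset.card_insert_of_notMem hzS,
    ← ENNReal.ofReal_mul (by positivity), ← ENNReal.ofReal_mul (by positivity)]
  congr 2
  · rw [Nat.sub_add_comm hcard, pow_succ]
    ring_nf
  · rw [Nat.add_sub_add_right, pow_succ]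
    ring_nf
  · congr 1
    ext ξ
    simp only [Function.comp]
    rw [Finset.sum_insert hzS, smul_add (C * σ), smul_inv_smul₀ (by positivity)]
    congr 3
    abel

theorem holderDom_dpsgdStep (hq : 0 ≤ q) (hq1 : q ≤ 1) (hσ : 0 < σ) (hC : 0 < C) {m : ℕ}
    (hm2 : 2 ≤ m) (hm : 2 * m ≤ σ ^ 2) (D : Finset Z) (z : Z) (hz : z ∉ D) (θ : E) :
    HolderDom (m / (m - 1)) (ENNReal.ofReal (Real.exp (2 * q ^ 2 * m / σ ^ 2)))
        (dpsgdStep q σ C η b g (D.cons z hz) θ) (dpsgdStep q σ C η b g D θ) ∧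
      HolderDom (m / (m - 1)) (ENNReal.ofReal (Real.exp (2 * q ^ 2 * m / σ ^ 2)))
        (dpsgdStep q σ C η b g D θ) (dpsgdStep q σ C η b g (D.cons z hz) θ) := by
  rw [dpsgdStep_cons hq hq1 hσ hC, dpsgdStep]
  set h := (C * σ)⁻¹ • clip C (g z θ)
  have hn : ‖h‖ ^ 2 ≤ 1 / σ ^ 2 := by
    have h1 : ‖h‖ ≤ 1 / σ := by
      rw [norm_smul, Real.norm_of_nonneg (by positivity)]
      calc (C * σ)⁻¹ * ‖clip C (g z θ)‖ ≤ (C * σ)⁻¹ * C := by gcongr; exact norm_clip_le hC _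
        _ = 1 / σ := by field_simp
    calc ‖h‖ ^ 2 ≤ (1 / σ) ^ 2 := by gcongr
      _ = _ := by rw [div_pow, one_pow]
  have hm' : 2 * ‖h‖ ^ 2 * m ≤ 1 := by
    calc 2 * ‖h‖ ^ 2 * m ≤ 2 * (1 / σ ^ 2) * m := by gcongr
      _ = 2 * m / σ ^ 2 := by ring
      _ ≤ 1 := by rw [div_le_one (by positivity)]; exact hm
  have hM : ENNReal.ofReal (Real.exp (2 * q ^ 2 * ‖h‖ ^ 2 * m)) ≤
      ENNReal.ofReal (Real.exp (2 * q ^ 2 * m / σ ^ 2)) := by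
    refine ENNReal.ofReal_le_ofReal (Real.exp_le_exp.2 ?_)
    calc 2 * q ^ 2 * ‖h‖ ^ 2 * m ≤ 2 * q ^ 2 * (1 / σ ^ 2) * m := by gcongr
      _ = _ := by ring
  have hp : 1 ≤ (m : ℝ) / (m - 1) := (holderConjugate_nat hm2).symm.lt.le
  exact ⟨HolderDom.finset_sum (sum_batch_weight hq hq1 D) hp fun S =>
      ((holderDom_gaussianMix hq hq1 h hm2 hm').mono hM).map (by fun_prop),
    HolderDom.finset_sum (sum_batch_weight hq hq1 D) hp fun S =>
      ((holderDom_stdGaussian hq hq1 h hm2 hm').mono hM).map (by fun_prop)⟩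

theorem isProbabilityMeasure_dpsgdRun (hq : 0 ≤ q) (hq1 : q ≤ 1) (hg : ∀ z, Measurable (g z))
    (D : Finset Z) (s : ℕ) (θ : E) : IsProbabilityMeasure (dpsgdRun q σ C η b g D s θ) := by
  induction s with
  | zero => exact Measure.dirac.isProbabilityMeasure
  | succ s ih =>
    exact isProbabilityMeasure_bind (measurable_dpsgdStep hg D).aemeasurable
      (Filter.Eventually.of_forall fun θ => isProbabilityMeasure_dpsgdStep hq hq1 D θ)

theorem measurable_dpsgdRun (hg : ∀ z, Measurable (g z)) (D : Finset Z) (s : ℕ) :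
    Measurable (dpsgdRun q σ C η b g D s) := by
  induction s with
  | zero => exact Measure.measurable_dirac
  | succ s ih => exact (Measure.measurable_bind' (measurable_dpsgdStep hg D)).comp ih

theorem holderDom_dpsgdRun (hg : ∀ z, Measurable (g z)) {p : ℝ} (hp : 1 ≤ p) {M : ENNReal}
    {D D' : Finset Z}
    (h : ∀ θ, HolderDom p M (dpsgdStep q σ C η b g D θ) (dpsgdStep q σ C η b g D' θ)) (s : ℕ)
    (θ : E) :
    HolderDom p (M ^ s) (dpsgdRun q σ C η b g D s θ) (dpsgdRun q σ C η b g D' s θ) := by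
  induction s with
  | zero => simpa [dpsgdRun] using HolderDom.refl hp (Measure.dirac θ)
  | succ s ih =>
    rw [pow_succ]
    exact ih.bind (by linarith) (measurable_dpsgdStep hg D) (measurable_dpsgdStep hg D') h

variable {n : ℕ} {cfg : FedConfig n}

theorem measurable_snoc_aggregate (w : Fin n → ℝ) (R : ℕ) :
    Measurable fun x : ((Fin R → Fin n → E) × E) × (Fin n → E) =>
      ((Fin.snoc x.1.1 x.2 : Fin (R + 1) → Fin n → E), ∑ i, w i • x.2 i) := by
  refine Measurable.prodMk (measurable_pi_lambda _ fun a => ?_) (by fun_prop)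
  induction a using Fin.lastCases with
  | last => simpa using measurable_snd
  | cast a =>
    simp only [Fin.snoc_castSucc]
    fun_prop

theorem measurable_fedAvg_round (hq : 0 ≤ cfg.q) (hq1 : cfg.q ≤ 1) (hg : ∀ z, Measurable (g z))
    (D : Fin n → Finset Z) (R : ℕ) :
    Measurable fun p : (Fin R → Fin n → E) × E =>
      (Measure.pi fun i =>
        dpsgdRun cfg.q cfg.σ cfg.C cfg.η (cfg.batch i) g (D i) cfg.localSteps p.2).map
        fun u => ((Fin.snoc p.1 u : Fin (R + 1) → Fin n → E), ∑ i, cfg.weight i • u i) := by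
  have := fun (i : Fin n) (θ : E) => isProbabilityMeasure_dpsgdRun (σ := cfg.σ) (C := cfg.C)
    (η := cfg.η) (b := cfg.batch i) hq hq1 hg (D i) cfg.localSteps θ
  refine measurable_map_of_uncurry ?_ ?_
  · exact measurable_measure_pi fun i => (measurable_dpsgdRun hg (D i) _).comp measurable_snd
  · exact measurable_snoc_aggregate cfg.weight R

theorem isProbabilityMeasure_fedAvgRun (hq : 0 ≤ cfg.q) (hq1 : cfg.q ≤ 1)
    (hg : ∀ z, Measurable (g z)) (θ₀ : E) (D : Fin n → Finset Z) (R : ℕ) :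
    IsProbabilityMeasure (fedAvgRun cfg g θ₀ D R) := by
  induction R with
  | zero => exact Measure.dirac.isProbabilityMeasure
  | succ R ih =>
    refine isProbabilityMeasure_bind (measurable_fedAvg_round hq hq1 hg D R).aemeasurable
      (Filter.Eventually.of_forall fun p => ?_)
    have := fun (i : Fin n) => isProbabilityMeasure_dpsgdRun (σ := cfg.σ) (C := cfg.C)
      (η := cfg.η) (b := cfg.batch i) hq hq1 hg (D i) cfg.localSteps p.2
    refine Measure.isProbabilityMeasure_map
      ((measurable_snoc_aggregate cfg.weight R).comp measurable_prodMk_left).aemeasurable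

theorem holderDom_fedAvgRun (hq : 0 ≤ cfg.q) (hq1 : cfg.q ≤ 1) (hg : ∀ z, Measurable (g z))
    {p : ℝ} (hp : 1 ≤ p) {M : ENNReal} {D D' : Fin n → Finset Z} (j : Fin n)
    (hD : ∀ i, i ≠ j → D i = D' i)
    (h : ∀ θ, HolderDom p M (dpsgdStep cfg.q cfg.σ cfg.C cfg.η (cfg.batch j) g (D j) θ)
      (dpsgdStep cfg.q cfg.σ cfg.C cfg.η (cfg.batch j) g (D' j) θ)) (θ₀ : E) (R : ℕ) :
    HolderDom p (M ^ (R * cfg.localSteps)) (fedAvgRun cfg g θ₀ D R) (fedAvgRun cfg g θ₀ D' R) := by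
  induction R with
  | zero => simpa [fedAvgRun] using HolderDom.refl hp (Measure.dirac _)
  | succ R ih =>
    rw [add_mul, one_mul, pow_add]
    refine ih.bind (by linarith) (measurable_fedAvg_round hq hq1 hg D R)
      (measurable_fedAvg_round hq hq1 hg D' R) fun x => HolderDom.map ?_ ?_
    · have h1 := fun (D : Finset Z) (i : Fin n) => isProbabilityMeasure_dpsgdRun (σ := cfg.σ)
        (C := cfg.C) (η := cfg.η) (b := cfg.batch i) hq hq1 hg D cfg.localSteps x.2
      exact HolderDom.pi hp j (holderDom_dpsgdRun hg hp h _ _) fun i hi => by rw [hD i hi]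
    · exact (measurable_snoc_aggregate cfg.weight R).comp measurable_prodMk_left

end Training

/-! ### From Hölder domination to differential privacy -/

theorem measurable_gradient {F : Type*} [NormedAddCommGroup F] [InnerProductSpace ℝ F]
    [CompleteSpace F] [MeasurableSpace F] [BorelSpace F] (f : F → ℝ) : Measurable (gradient f) :=
  (InnerProductSpace.toDual ℝ F).symm.continuous.measurable.comp (measurable_fderiv ℝ f)

theorem IsDP.map {Z Ω Ω' : Type*} [MeasurableSpace Ω] [MeasurableSpace Ω'] {ε δ : ℝ}
    {M : Finset Z → Measure Ω} (h : IsDP ε δ M) {f : Ω → Ω'} (hf : Measurable f) :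
    IsDP ε δ fun D => (M D).map f := by
  refine ⟨fun D => ?_, fun D D' hD S hS => ?_⟩
  · have := h.1 D
    exact Measure.isProbabilityMeasure_map hf.aemeasurable
  · rw [Measure.map_apply hf hS, Measure.map_apply hf hS]
    exact h.2 D D' hD _ (hf hS)

section Training

variable {Z E : Type*} [NormedAddCommGroup E] [InnerProductSpace ℝ E] [FiniteDimensional ℝ E]
  [MeasurableSpace E] [BorelSpace E] {n : ℕ} {cfg : FedConfig n} {g : Z → E → E}

theorem holderDom_fedTrain_cons (hq : 0 ≤ cfg.q) (hq1 : cfg.q ≤ 1) (hσ : 0 < cfg.σ)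
    (hC : 0 < cfg.C) (hg : ∀ z, Measurable (g z)) {m : ℕ} (hm2 : 2 ≤ m) (hm : 2 * m ≤ cfg.σ ^ 2)
    (θ₀ : E) (owner : Z → Fin n) (D : Finset Z) (z : Z) (hz : z ∉ D) :
    HolderDom (m / (m - 1))
        (ENNReal.ofReal (Real.exp (2 * cfg.q ^ 2 * m / cfg.σ ^ 2 * cfg.totalSteps)))
        (fedTrain cfg g θ₀ owner (D.cons z hz)) (fedTrain cfg g θ₀ owner D) ∧
      HolderDom (m / (m - 1))
        (ENNReal.ofReal (Real.exp (2 * cfg.q ^ 2 * m / cfg.σ ^ 2 * cfg.totalSteps)))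
        (fedTrain cfg g θ₀ owner D) (fedTrain cfg g θ₀ owner (D.cons z hz)) := by
  have hM : ENNReal.ofReal (Real.exp (2 * cfg.q ^ 2 * m / cfg.σ ^ 2 * cfg.totalSteps)) =
      ENNReal.ofReal (Real.exp (2 * cfg.q ^ 2 * m / cfg.σ ^ 2)) ^ (cfg.rounds * cfg.localSteps) := by
    rw [← ENNReal.ofReal_pow (Real.exp_pos _).le, ← Real.exp_nat_mul, FedConfig.totalSteps,
      mul_comm]
  have hp : 1 ≤ (m : ℝ) / (m - 1) := (holderConjugate_nat hm2).symm.lt.le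
  have hself : (D.cons z hz).filter (fun x => owner x = owner z) =
      (D.filter fun x => owner x = owner z).cons z (by simp [hz]) :=
    Finset.filter_cons_of_pos _ _ _ _ rfl
  have hne : ∀ i, i ≠ owner z →
      (D.cons z hz).filter (fun x => owner x = i) = D.filter fun x => owner x = i :=
    fun i hi => Finset.filter_cons_of_neg _ _ _ _ hi.symm
  have key := fun θ => holderDom_dpsgdStep (η := cfg.η) (b := cfg.batch (owner z)) (g := g) hq hq1
    hσ hC hm2 hm (D.filter fun x => owner x = owner z) z (by simp [hz]) θ
  rw [hM]
  constructor
  · refine holderDom_fedAvgRun hq hq1 hg hp (owner z) hne (fun θ => ?_) θ₀ _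
    rw [hself]
    exact (key θ).1
  · refine holderDom_fedAvgRun hq hq1 hg hp (owner z) (fun i hi => (hne i hi).symm)
      (fun θ => ?_) θ₀ _
    rw [hself]
    exact (key θ).2

theorem isDP_fedTrain {ε δ : ℝ} (hq : 0 ≤ cfg.q) (hq1 : cfg.q ≤ 1) (hσ : 0 < cfg.σ)
    (hC : 0 < cfg.C) (hg : ∀ z, Measurable (g z)) {m : ℕ} (hm2 : 2 ≤ m) (hm : 2 * m ≤ cfg.σ ^ 2)
    (hε : 0 < ε) (hδ : 0 < δ) (hεm : 16 * Real.log (1 / δ) ≤ ε * m)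
    (hεσ : 32 * cfg.q ^ 2 * m / cfg.σ ^ 2 * cfg.totalSteps ≤ ε) (hδ1 : δ < 1)
    (θ₀ : E) (owner : Z → Fin n) : IsDP ε δ (fedTrain cfg g θ₀ owner) := by
  have hprob : ∀ D, IsProbabilityMeasure (fedTrain cfg g θ₀ owner D) :=
    fun D => isProbabilityMeasure_fedAvgRun hq hq1 hg θ₀ _ _
  refine ⟨hprob, fun D D' hD S hS => ?_⟩
  set a := 2 * cfg.q ^ 2 * m / cfg.σ ^ 2 * cfg.totalSteps with ha
  have ha0 : 0 ≤ a := by positivity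
  have h1a : (1 : ENNReal) ≤ ENNReal.ofReal (Real.exp a) := by
    rw [← ENNReal.ofReal_one]
    exact ENNReal.ofReal_le_ofReal (Real.one_le_exp ha0)
  have hp : 1 ≤ (m : ℝ) / (m - 1) := (holderConjugate_nat hm2).symm.lt.le
  have key := holderDom_fedTrain_cons hq hq1 hσ hC hg hm2 hm θ₀ owner
  have hrefl : ∀ D, HolderDom (m / (m - 1)) (ENNReal.ofReal (Real.exp a))
      (fedTrain cfg g θ₀ owner D) (fedTrain cfg g θ₀ owner D) :=
    fun D => (HolderDom.refl hp _).mono h1a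
  -- For a replacement, `U` is the common part, so the two records may have different owners.
  -- Addition and removal fit the same pattern with one trivial leg.
  obtain ⟨U, h1, h2⟩ : ∃ U, HolderDom (m / (m - 1)) (ENNReal.ofReal (Real.exp a))
        (fedTrain cfg g θ₀ owner D) (fedTrain cfg g θ₀ owner U) ∧
      HolderDom (m / (m - 1)) (ENNReal.ofReal (Real.exp a))
        (fedTrain cfg g θ₀ owner U) (fedTrain cfg g θ₀ owner D') := by
    rcases hD with ⟨z, hz, rfl⟩ | ⟨z, hz, rfl⟩ | ⟨U, x, y, hx, hy, _, rfl, rfl⟩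
    · exact ⟨D, hrefl D, (key D z hz).2⟩
    · exact ⟨D', (key D' z hz).1, hrefl D'⟩
    · exact ⟨U, (key U x hx).1, (key U y hy).2⟩
  have hm2' : (2 : ℝ) ≤ m := by exact_mod_cast hm2
  have hm1 : (0 : ℝ) < m - 1 := by linarith
  have h3 := (h1.trans (by positivity) h2).mono (M' := ENNReal.ofReal (Real.exp (2 * a))) (by
    calc ENNReal.ofReal (Real.exp a) * ENNReal.ofReal (Real.exp a) ^ (1 / ((m : ℝ) / (m - 1)))
        ≤ ENNReal.ofReal (Real.exp a) * ENNReal.ofReal (Real.exp a) ^ (1 : ℝ) := by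
          gcongr
          rw [div_le_one (by positivity)]
          exact hp
      _ = _ := by
        rw [ENNReal.rpow_one, ← ENNReal.ofReal_mul (Real.exp_pos _).le, ← Real.exp_add, two_mul])
  set u : ℝ := 1 / m with hu
  have hu0 : 0 < u := by positivity
  have hu1 : u ≤ 1 / 2 := by
    rw [hu]; gcongr
  have hθ : (m : ℝ) / (m - 1) * (m / (m - 1)) = 1 / (1 - u) ^ 2 := by
    rw [hu]; field_simp
  rw [hθ] at h3
  refine h3.measure_le (by nlinarith) (by nlinarith) hδ ?_ hS
  have hL : Real.log δ = - Real.log (1 / δ) := by rw [one_div, Real.log_inv, neg_neg]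
  rw [hL]
  have hLpos : 0 < Real.log (1 / δ) := Real.log_pos (by rw [one_lt_div hδ]; exact hδ1)
  set Λ := Real.log (1 / δ)
  -- Budget: `ε * (1 - u) ^ 2` is at least `ε / 4`, while the loss `2 * a` and the `δ` term `2 * u *
  -- Λ` each take at most `ε / 8`.
  have h4 : 16 * (u * Λ) ≤ ε := by
    have : 16 * (u * Λ) = u * (16 * Λ) := by ring
    rw [this, hu]
    calc 1 / (m : ℝ) * (16 * Λ) ≤ 1 / m * (ε * m) := by gcongr
      _ = ε := by field_simp
  have h5 : 16 * a ≤ ε := by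
    refine le_trans (le_of_eq ?_) hεσ
    rw [ha]; ring
  have h6 : 1 / 4 ≤ (1 - u) ^ 2 := by nlinarith
  have h7 : (1 - (1 - u) ^ 2) * Λ ≤ 2 * (u * Λ) := by nlinarith [mul_pos (pow_pos hu0 2) hLpos]
  nlinarith

end Training

/-! ### Choice of the order and conclusion -/

/-- The order of the moment bound, and the estimates on it that the privacy analysis needs. -/
theorem exists_moment_order {K : ℝ} (hK : 0 < K) :
    ∃ c : ℝ, 0 < c ∧ ∀ q σ ε Λ : ℝ, ∀ T : ℕ, 0 < q → 0 < ε → 0 < Λ → ε ≤ K * (q ^ 2 * T) →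
      ε ≤ K * Λ → c * (q * Real.sqrt (T * Λ) / ε) ≤ σ →
      0 < σ ∧ ∃ m : ℕ, 2 ≤ m ∧ 2 * m ≤ σ ^ 2 ∧ 16 * Λ ≤ ε * m ∧
        32 * q ^ 2 * m / σ ^ 2 * T ≤ ε := by
  set A := 16 + 3 * K with hA
  -- `A` is chosen so that `ε * m ≤ A * Λ`, with `3 * K` paying for rounding and the `+ 2`. The
  -- constant `c` must exceed `2 * A * K` for the order restriction and `32 * A` for the budget; `c
  -- ≥ 1` lets `c` replace `c ^ 2`.
  refine ⟨32 * A * (1 + K), by positivity, fun q σ ε Λ T hq hε hΛ h1 h2 h3 => ?_⟩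
  set c := 32 * A * (1 + K) with hc
  have hA0 : 0 < A := by positivity
  have hc0 : 0 < c := by positivity
  have hc1 : 1 ≤ c := by nlinarith [mul_pos hA0 hK]
  have hT : (0 : ℝ) < T := by
    by_contra! hT
    nlinarith [mul_pos hK (pow_pos hq 2)]
  have hσ : 0 < σ := lt_of_lt_of_le (by positivity) h3
  have hσ2 : c * (q ^ 2 * T * Λ) ≤ σ ^ 2 * ε ^ 2 := by
    calc c * (q ^ 2 * T * Λ) ≤ c ^ 2 * (q ^ 2 * T * Λ) := by gcongr; nlinarith
      _ = (c * (q * Real.sqrt (T * Λ) / ε)) ^ 2 * ε ^ 2 := by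
        rw [mul_pow c, div_pow, mul_pow q, Real.sq_sqrt (by positivity)]
        field_simp
      _ ≤ _ := by gcongr
  refine ⟨hσ, ⌈16 * Λ / ε⌉₊ + 2, by omega, ?_⟩
  set m := ⌈16 * Λ / ε⌉₊ + 2 with hm
  have hmlow : 16 * Λ ≤ ε * m := by
    have := Nat.le_ceil (16 * Λ / ε)
    rw [div_le_iff₀ hε] at this
    rw [hm]; push_cast; nlinarith
  have hmup : ε * m ≤ A * Λ := by
    have := (Nat.ceil_lt_add_one (a := 16 * Λ / ε) (by positivity)).le
    have h4 : (m : ℝ) ≤ 16 * Λ / ε + 3 := by rw [hm]; push_cast; linarith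
    calc ε * m ≤ ε * (16 * Λ / ε + 3) := by gcongr
      _ = 16 * Λ + 3 * ε := by field_simp
      _ ≤ A * Λ := by rw [hA]; linarith
  refine ⟨?_, hmlow, ?_⟩
  · have h5 : c * (ε * Λ) ≤ K * (σ ^ 2 * ε ^ 2) := by
      calc c * (ε * Λ) ≤ c * (K * (q ^ 2 * T) * Λ) := by gcongr
        _ = K * (c * (q ^ 2 * T * Λ)) := by ring
        _ ≤ _ := by gcongr
    have h6 : 2 * A * K * (ε * Λ) ≤ c * (ε * Λ) := by
      gcongr
      rw [hc]; nlinarith [mul_pos hA0 hK]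
    have h7 : 2 * (m : ℝ) * (K * ε ^ 2) ≤ σ ^ 2 * (K * ε ^ 2) := by
      calc 2 * (m : ℝ) * (K * ε ^ 2) = 2 * K * ε * (ε * m) := by ring
        _ ≤ 2 * K * ε * (A * Λ) := by gcongr
        _ = 2 * A * K * (ε * Λ) := by ring
        _ ≤ _ := h6
        _ ≤ _ := h5
        _ = _ := by ring
    exact le_of_mul_le_mul_right h7 (by positivity)
  · rw [div_mul_eq_mul_div, div_le_iff₀ (by positivity)]
    refine le_of_mul_le_mul_right (a := ε) ?_ hε
    calc 32 * q ^ 2 * m * T * ε = 32 * (q ^ 2 * T) * (ε * m) := by ring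
      _ ≤ 32 * (q ^ 2 * T) * (A * Λ) := by gcongr
      _ = 32 * A * (q ^ 2 * T * Λ) := by ring
      _ ≤ c * (q ^ 2 * T * Λ) := by
        gcongr
        rw [hc]; nlinarith [mul_pos hA0 hK]
      _ ≤ σ ^ 2 * ε ^ 2 := hσ2
      _ = _ := by ring

theorem mainTheorem3 (K : ℝ) (hK : 0 < K) :
    ∃ c : ℝ, 0 < c ∧
      ∀ {Z : Type*} {n : ℕ} (owner : Z → Fin n)
        {L : ℕ} {d k : Fin L → ℕ} {r : ℕ}
        (loss : Z → Weights d k → ℝ) (W₀ : Weights d k) (α : ℝ)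
        (A₀ : (l : Fin L) → Matrix (Fin r) (Fin (k l)) ℝ)
        (θ₀ : LoRAParams d k r) (φ₀ : FFAParams d r)
        (cfg : FedConfig n) (ε δ : ℝ),
        0 < cfg.q → cfg.q ≤ 1 → 0 < cfg.C → (∀ i, 0 < cfg.batch i) →
        (∀ i, 0 ≤ cfg.weight i) → ∑ i, cfg.weight i = 1 →
        0 < ε → 0 < δ → δ < 1 →
        ε ≤ K * (cfg.q ^ 2 * cfg.totalSteps) → ε ≤ K * Real.log (1 / δ) →
        c * (cfg.q * Real.sqrt (cfg.totalSteps * Real.log (1 / δ)) / ε) ≤ cfg.σ →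
        (IsDP ε δ (fedTrain cfg (loraGrad loss W₀ α) θ₀ owner) ∧
          IsDP ε δ (fedTrainFinal cfg (loraGrad loss W₀ α) θ₀ owner)) ∧
        (IsDP ε δ (fedTrain cfg (ffaGrad loss W₀ α A₀) φ₀ owner) ∧
          IsDP ε δ (fedTrainFinal cfg (ffaGrad loss W₀ α A₀) φ₀ owner)) := by
  obtain ⟨c, hc, h⟩ := exists_moment_order hK
  refine ⟨c, hc, ?_⟩
  intro Z n owner L d k r loss W₀ α A₀ θ₀ φ₀ cfg ε δ hq hq1 hC _ _ _ hε hδ hδ1 h1 h2 h3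
  have hΛ : 0 < Real.log (1 / δ) := Real.log_pos (by rw [one_lt_div hδ]; exact hδ1)
  obtain ⟨hσ, m, hm2, hm, hεm, hεσ⟩ := h _ _ _ _ _ hq hε hΛ h1 h2 h3
  have hlora := isDP_fedTrain (g := loraGrad loss W₀ α) hq.le hq1 hσ hC
    (fun z => measurable_gradient _) hm2 hm hε hδ hεm hεσ hδ1 θ₀ owner
  have hffa := isDP_fedTrain (g := ffaGrad loss W₀ α A₀) hq.le hq1 hσ hC
    (fun z => measurable_gradient _) hm2 hm hε hδ hεm hεσ hδ1 φ₀ owner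
  exact ⟨⟨hlora, hlora.map measurable_snd⟩, hffa, hffa.map measurable_snd⟩
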